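/- Let $d\ge 1$ and $n\ge 2$ be integers. For a real tensor $T=(t_{i_1\dots i_d})_{1\le i_1,\dots,i_d\le n}$ let $\langle T,T'\rangle=\sum_{i_1,\dots,i_d}t_{i_1\dots i_d}t'_{i_1\dots i_d}$ be the Frobenius product, $\|T\|=\sqrt{\langle T,T\rangle}$ the Frobenius norm, and $$\|T\|_\infty=\max\bigl\{|\langle T,\mathbf x^1\otimes\cdots\otimes\mathbf x^d\rangle| : \mathbf x^1,\dots,\mathbf x^d\in\mathbb R^n,\ \|\mathbf x^1\|_2=\dots=\|\mathbf x^d\|_2=1\bigr\}$$ the spectral norm, where $\mathbf x^1\otimes\cdots\otimes\mathbf x^d$ has entries $x^1_{i_1}\cdots x^d_{i_d}$. Let $\mathrm{Sym}^d(\mathbb R^n)$ be the space of symmetric tensors, that is, of those $T$ with $t_{i_{\sigma(1)}\dots i_{\sigma(d)}}=t_{i_1\dots i_d}$ for all permutations $\sigma$ of $\{1,\dots,d\}$ and all indices, and let $$\mathcal A(\mathrm{Sym}^d(\mathbb R^n))=\min_{0\ne T\in\mathrm{Sym}^d(\mathbb R^n)}\frac{\|T\|_\infty}{\|T\|}$$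 be its best rank-one approximation ratio. Then $$\mathcal A(\mathrm{Sym}^d(\mathbb R^n))\ \ge\ \max\left\{\frac1{2^{d/2}}\binom{d+n-1}{d}^{-1/2},\ \frac1{n^{(d-1)/2}}\right\}.$$ -/

import Mathlib

/-- Real tensors `T = (t_{i₁…i_d})` of format `(n, …, n)` (`d` factors). The norm and the inner
product of this Euclidean space are the Frobenius norm and the Frobenius product. -/
abbrev RealTensor (d n : ℕ) : Type :=
  EuclideanSpace ℝ (Fin d → Fin n)

/-- `Sym^d(ℝⁿ)`: the tensors whose entries are unchanged by permutations of the `d` indices. -/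
def symTensor (d n : ℕ) : Submodule ℝ (RealTensor d n) where
  carrier := {T | ∀ (σ : Equiv.Perm (Fin d)) (i : Fin d → Fin n), T (i ∘ σ) = T i}
  add_mem' := by
    intro S T hS hT σ i
    simp only [PiLp.add_apply, hS σ i, hT σ i]
  zero_mem' := by
    intro σ i
    simp
  smul_mem' := by
    intro c T hT σ i
    simp only [PiLp.smul_apply, hT σ i]

/-- The tensor `x¹ ⊗ ⋯ ⊗ x^d`, with entries `x¹_{i₁} ⋯ x^d_{i_d}`. -/
noncomputable def rankOneTensor {d n : ℕ} (x : Fin d → EuclideanSpace ℝ (Fin n)) :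
    RealTensor d n :=
  WithLp.toLp 2 (fun i => ∏ j, x j (i j))

/-- The values `|⟨T, x¹ ⊗ ⋯ ⊗ x^d⟩|` at unit vectors `x¹, …, x^d` of `ℝⁿ`. -/
def spectralValues {d n : ℕ} (T : RealTensor d n) : Set ℝ :=
  {r | ∃ x : Fin d → EuclideanSpace ℝ (Fin n),
    (∀ j, ‖x j‖ = 1) ∧ r = |inner ℝ T (rankOneTensor x)|}

/-- The spectral norm `‖T‖_∞ = max |⟨T, x¹ ⊗ ⋯ ⊗ x^d⟩|` over unit vectors; the maximum is attained
for `n ≥ 1`, see `isGreatest_tensorSpectralNorm`. -/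
noncomputable def tensorSpectralNorm {d n : ℕ} (T : RealTensor d n) : ℝ :=
  sSup (spectralValues T)

/-- The ratios `‖T‖_∞ / ‖T‖` of the nonzero symmetric tensors `T`. -/
def symRatios (d n : ℕ) : Set ℝ :=
  {r | ∃ T ∈ symTensor d n, T ≠ 0 ∧ r = tensorSpectralNorm T / ‖T‖}

/-- The best rank-one approximation ratio `𝒜(Sym^d(ℝⁿ)) = min ‖T‖_∞ / ‖T‖` over nonzero symmetric
`T`; the minimum is attained for `n ≥ 1`, see `isLeast_symRankOneRatio`. -/
noncomputable def symRankOneRatio (d n : ℕ) : ℝ :=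
  sInf (symRatios d n)

theorem continuous_rankOneTensor (d n : ℕ) :
    Continuous (rankOneTensor : (Fin d → EuclideanSpace ℝ (Fin n)) → RealTensor d n) := by
  unfold rankOneTensor
  fun_prop

theorem isCompact_unitTuples (d n : ℕ) :
    IsCompact {x : Fin d → EuclideanSpace ℝ (Fin n) | ∀ j, ‖x j‖ = 1} := by
  have h := isCompact_univ_pi
    (fun _ : Fin d => isCompact_sphere (0 : EuclideanSpace ℝ (Fin n)) 1)
  convert h using 1
  ext x
  simp [Set.mem_pi]

/-- The spectral norm is a maximum. -/
theorem isGreatest_tensorSpectralNorm {d n : ℕ} (hn : 1 ≤ n) (T : RealTensor d n) :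
    IsGreatest (spectralValues T) (tensorSpectralNorm T) := by
  have himg : spectralValues T = (fun x => |inner ℝ T (rankOneTensor x)|) ''
      {x : Fin d → EuclideanSpace ℝ (Fin n) | ∀ j, ‖x j‖ = 1} := by
    ext r
    constructor
    · rintro ⟨x, hx, rfl⟩
      exact ⟨x, hx, rfl⟩
    · rintro ⟨x, hx, rfl⟩
      exact ⟨x, hx, rfl⟩
  have hcont : Continuous (fun x : Fin d → EuclideanSpace ℝ (Fin n) =>
      |inner ℝ T (rankOneTensor x)|) := by
    have := continuous_rankOneTensor d n
    fun_prop
  have hc : IsCompact (spectralValues T) := by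
    rw [himg]
    exact (isCompact_unitTuples d n).image hcont
  have hne : (spectralValues T).Nonempty :=
    ⟨_, fun _ => EuclideanSpace.single (⟨0, hn⟩ : Fin n) (1 : ℝ), by simp, rfl⟩
  exact hc.isGreatest_sSup hne

theorem norm_rankOneTensor {d n : ℕ} (x : Fin d → EuclideanSpace ℝ (Fin n))
    (hx : ∀ j, ‖x j‖ = 1) : ‖rankOneTensor x‖ = 1 := by
  have h : ‖rankOneTensor x‖ ^ 2 = 1 := by
    rw [EuclideanSpace.norm_sq_eq]
    simp only [rankOneTensor, Real.norm_eq_abs, sq_abs, ← Finset.prod_pow]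
    rw [← Fintype.piFinset_univ, Finset.sum_prod_piFinset Finset.univ (fun j k => (x j k) ^ 2)]
    refine Finset.prod_eq_one fun j _ => ?_
    have := EuclideanSpace.norm_sq_eq (x j)
    simpa [hx j] using this.symm
  nlinarith [norm_nonneg (rankOneTensor x)]

theorem tensorSpectralNorm_le_add {d n : ℕ} (hn : 1 ≤ n) (S T : RealTensor d n) :
    tensorSpectralNorm S ≤ tensorSpectralNorm T + ‖S - T‖ := by
  obtain ⟨x, hx, h⟩ := (isGreatest_tensorSpectralNorm hn S).1
  have h1 : |inner ℝ T (rankOneTensor x)| ≤ tensorSpectralNorm T :=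
    (isGreatest_tensorSpectralNorm hn T).2 ⟨x, hx, rfl⟩
  have h2 := abs_real_inner_le_norm (S - T) (rankOneTensor x)
  rw [norm_rankOneTensor x hx, mul_one, inner_sub_left] at h2
  have h3 := abs_sub_abs_le_abs_sub (inner ℝ S (rankOneTensor x)) (inner ℝ T (rankOneTensor x))
  rw [h]
  linarith

theorem continuous_tensorSpectralNorm {d n : ℕ} (hn : 1 ≤ n) :
    Continuous (tensorSpectralNorm : RealTensor d n → ℝ) := by
  have : LipschitzWith 1 (tensorSpectralNorm : RealTensor d n → ℝ) := by
    refine LipschitzWith.of_le_add fun S T => ?_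
    rw [dist_eq_norm]
    exact tensorSpectralNorm_le_add hn S T
  exact this.continuous

open scoped Pointwise in
theorem tensorSpectralNorm_smul {d n : ℕ} (c : ℝ) (T : RealTensor d n) :
    tensorSpectralNorm (c • T) = |c| * tensorSpectralNorm T := by
  have : spectralValues (c • T) = |c| • spectralValues T := by
    ext r
    simp only [spectralValues, Set.mem_smul_set, Set.mem_ofPred_eq, smul_eq_mul]
    constructor
    · rintro ⟨x, hx, rfl⟩
      exact ⟨_, ⟨x, hx, rfl⟩, by rw [real_inner_smul_left, abs_mul]⟩
    · rintro ⟨_, ⟨x, hx, rfl⟩, rfl⟩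
      exact ⟨x, hx, by rw [real_inner_smul_left, abs_mul]⟩
  rw [tensorSpectralNorm, this, Real.sSup_smul_of_nonneg (abs_nonneg c), smul_eq_mul,
    tensorSpectralNorm]

/-- The best rank-one approximation ratio is a minimum. -/
theorem isLeast_symRankOneRatio {d n : ℕ} (hn : 1 ≤ n) :
    IsLeast (symRatios d n) (symRankOneRatio d n) := by
  have himg : symRatios d n = tensorSpectralNorm ''
      ((symTensor d n : Set (RealTensor d n)) ∩ Metric.sphere 0 1) := by
    ext r
    constructor
    · rintro ⟨T, hT, h0, rfl⟩
      have hp : 0 < ‖T‖ := norm_pos_iff.2 h0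
      refine ⟨‖T‖⁻¹ • T, ⟨(symTensor d n).smul_mem _ hT, ?_⟩, ?_⟩
      · simp [norm_smul, hp.ne']
      · rw [tensorSpectralNorm_smul, abs_of_pos (inv_pos.2 hp), div_eq_inv_mul]
    · rintro ⟨T, ⟨hT, h1⟩, rfl⟩
      have h1' : ‖T‖ = 1 := by simpa using h1
      exact ⟨T, hT, norm_ne_zero_iff.1 (by rw [h1']; exact one_ne_zero), by rw [h1', div_one]⟩
  have hc : IsCompact (symRatios d n) := by
    rw [himg]
    exact ((isCompact_sphere _ _).inter_left (symTensor d n).closed_of_finiteDimensional).image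
      (continuous_tensorSpectralNorm hn)
  have hne : (symRatios d n).Nonempty := by
    refine ⟨_, rankOneTensor fun _ => EuclideanSpace.single (⟨0, hn⟩ : Fin n) (1 : ℝ), ?_, ?_, rfl⟩
    · intro σ i
      exact Equiv.prod_comp σ
        (fun j => (EuclideanSpace.single (⟨0, hn⟩ : Fin n) (1 : ℝ)) (i j))
    · refine norm_ne_zero_iff.1 ?_
      rw [norm_rankOneTensor _ (by simp)]
      exact one_ne_zero
  exact hc.isLeast_sInf hne

section

open MeasureTheory ProbabilityTheory MvPolynomial

/-! The minimum is attained, so each bound is proved for one symmetric T.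

First bound: let f(z) = ⟨T, z ⊗ ⋯ ⊗ z⟩ and let z be a standard Gaussian vector. Homogeneity gives
f(z)² ≤ ‖T‖_∞² |z|^{2d}, and E|z|^{2d} = n(n+2)⋯(n+2d-2) ≤ 2^d d! binom(d+n-1, d). In the other
direction E f² ≥ d! ‖T‖² (`factorial_mul_sum_sq_le_gaussianMean`). This follows by induction on d
from Σ E(∂ᵢf)² ≤ d E f², because ∂ᵢf is d times the form of the i-th slice of T. Gaussian
integration by parts and Euler's identity reduce that inequality to E(f Δf) ≥ 0.

Second bound: T splits into n^{d-1} vectors along its first index, each of norm at most ‖T‖_∞. -/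

/-! ### Gaussian moments and integration by parts -/

theorem integrable_pow_gaussianReal (k : ℕ) :
    Integrable (fun x : ℝ => x ^ k) (gaussianReal 0 1) := by
  rcases Nat.eq_zero_or_pos k with rfl | hk
  · simp
  · have h := (memLp_id_gaussianReal (μ := 0) (v := 1) (k : NNReal)).integrable_norm_pow
      (by simpa using hk.ne')
    refine (integrable_norm_iff (by fun_prop)).1 ?_
    simpa using h

theorem hasDerivAt_gaussianPDFReal (x : ℝ) :
    HasDerivAt (gaussianPDFReal 0 1) (-x * gaussianPDFReal 0 1 x) x := by
  have h : HasDerivAt (fun x : ℝ => -(x - 0) ^ 2 / (2 * ((1 : NNReal) : ℝ))) (-x) x := by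
    have := ((((hasDerivAt_id x).sub_const 0).pow 2).neg).div_const (2 * ((1 : NNReal) : ℝ))
    exact this.congr_deriv (by simp; ring)
  have h2 := h.exp.const_mul (√(2 * Real.pi * ((1 : NNReal) : ℝ)))⁻¹
  rw [gaussianPDFReal_def]
  exact h2.congr_deriv (by ring)

/-- Integration by parts against the density φ, which satisfies φ' = -xφ. At k = 0 the truncated
exponent is harmless, since its coefficient vanishes. -/
theorem integral_pow_gaussianReal_succ (k : ℕ) :
    ∫ x, x ^ (k + 1) ∂gaussianReal 0 1 = k * ∫ x, x ^ (k - 1) ∂gaussianReal 0 1 := by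
  have hint (m : ℕ) : Integrable (fun x : ℝ => x ^ m * gaussianPDFReal 0 1 x) := by
    have h := integrable_pow_gaussianReal m
    rw [gaussianReal_of_var_ne_zero _ one_ne_zero,
      integrable_withDensity_iff (measurable_gaussianPDF _ _)
        (Filter.Eventually.of_forall fun _ => gaussianPDF_lt_top)] at h
    simpa using h
  have hI (m : ℕ) : ∫ x, x ^ m ∂gaussianReal 0 1 = ∫ x : ℝ, x ^ m * gaussianPDFReal 0 1 x := by
    rw [integral_gaussianReal_eq_integral_smul one_ne_zero]
    simp [mul_comm]
  have key := integral_mul_deriv_eq_deriv_mul_of_integrable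
    (u := fun x : ℝ => x ^ k) (u' := fun x => k * x ^ (k - 1))
    (v := gaussianPDFReal 0 1) (v' := fun x => -x * gaussianPDFReal 0 1 x)
    (fun x _ => hasDerivAt_pow k x) (fun x _ => hasDerivAt_gaussianPDFReal x)
    ((hint (k + 1)).neg.congr (.of_forall fun x => by simp; ring))
    (((hint (k - 1)).const_mul (k : ℝ)).congr (.of_forall fun x => by simp; ring)) (hint k)
  rw [hI, hI, ← integral_const_mul]
  rw [← neg_inj, ← integral_neg]
  convert key using 1
  · congr 1; ext x; ring
  · congr 2; ext x; ring

/-- The standard Gaussian measure on `ℝⁿ`. -/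
noncomputable def stdGaussianPi (n : ℕ) : Measure (Fin n → ℝ) :=
  Measure.pi fun _ => gaussianReal 0 1

theorem eval_monomial_eq_prod {n : ℕ} (a : Fin n →₀ ℕ) (c : ℝ) (z : Fin n → ℝ) :
    eval z (monomial a c) = c * ∏ i, z i ^ a i := by
  rw [eval_monomial, Finsupp.prod_fintype _ _ (by simp)]

theorem integrable_eval_stdGaussianPi {n : ℕ} (f : MvPolynomial (Fin n) ℝ) :
    Integrable (fun z => eval z f) (stdGaussianPi n) := by
  induction f using MvPolynomial.induction_on' with
  | monomial a c =>
    simp only [eval_monomial_eq_prod]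
    exact (Integrable.fintype_prod fun i => integrable_pow_gaussianReal (a i)).const_mul c
  | add p q hp hq => simpa [Pi.add_def] using hp.add hq

/-- The expectation of a polynomial in `n` independent standard Gaussian variables. -/
noncomputable def gaussianMean (n : ℕ) : MvPolynomial (Fin n) ℝ →ₗ[ℝ] ℝ where
  toFun f := ∫ z, eval z f ∂stdGaussianPi n
  map_add' f g := by
    simp only [map_add]
    exact integral_add (integrable_eval_stdGaussianPi f) (integrable_eval_stdGaussianPi g)
  map_smul' c f := by
    simp only [smul_eval, RingHom.id_apply, smul_eq_mul]
    exact integral_const_mul _ _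

theorem gaussianMean_nonneg {n : ℕ} {f : MvPolynomial (Fin n) ℝ} (hf : ∀ z, 0 ≤ eval z f) :
    0 ≤ gaussianMean n f :=
  integral_nonneg hf

theorem gaussianMean_monomial {n : ℕ} (a : Fin n →₀ ℕ) (c : ℝ) :
    gaussianMean n (monomial a c) = c * ∏ i, ∫ x, x ^ a i ∂gaussianReal 0 1 := by
  change ∫ z, eval z (monomial a c) ∂stdGaussianPi n = _
  simp only [eval_monomial_eq_prod]
  rw [integral_const_mul, stdGaussianPi,
    integral_fintype_prod_eq_prod (fun i (x : ℝ) => x ^ a i)]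

theorem gaussianMean_one (n : ℕ) : gaussianMean n 1 = 1 := by
  have := gaussianMean_monomial (0 : Fin n →₀ ℕ) 1
  simpa using this

/-- Gaussian integration by parts. -/
theorem gaussianMean_X_mul {n : ℕ} (i : Fin n) (f : MvPolynomial (Fin n) ℝ) :
    gaussianMean n (X i * f) = gaussianMean n (pderiv i f) := by
  induction f using MvPolynomial.induction_on' with
  | monomial a c =>
    rw [X, monomial_mul, one_mul, pderiv_monomial, gaussianMean_monomial, gaussianMean_monomial,
      ← Finset.mul_prod_erase _ _ (Finset.mem_univ i),
      ← Finset.mul_prod_erase _ _ (Finset.mem_univ i)]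
    have h (k : Fin n) (hk : k ∈ Finset.univ.erase i) :
        (∫ x, x ^ ((Finsupp.single i 1 + a : Fin n →₀ ℕ) k) ∂gaussianReal 0 1) =
          ∫ x, x ^ ((a - Finsupp.single i 1 : Fin n →₀ ℕ) k) ∂gaussianReal 0 1 := by
      have hk' : i ≠ k := (Finset.ne_of_mem_erase hk).symm
      simp [Finsupp.single_eq_of_ne' hk']
    rw [Finset.prod_congr rfl h]
    have h' : (Finsupp.single i 1 + a : Fin n →₀ ℕ) i = a i + 1 := by simp [add_comm]
    rw [h', integral_pow_gaussianReal_succ]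
    simp
    ring
  | add p q hp hq => simp [mul_add, hp, hq]

/-- The squared Euclidean norm as a polynomial. -/
noncomputable def sumSq (n : ℕ) : MvPolynomial (Fin n) ℝ := ∑ i, X i * X i

theorem pderiv_sumSq {n : ℕ} (i : Fin n) : pderiv i (sumSq n) = 2 * X i := by
  simp only [sumSq, map_sum, Derivation.leibniz, smul_eq_mul, pderiv_X]
  rw [Finset.sum_eq_single i]
  · simp; ring
  · intro j _ hj; simp [hj]
  · simp

/-- Integrating each term of Σ Xᵢ · Xᵢ|X|^{2k} by parts gives E|X|^{2k+2} = (n + 2k) E|X|^{2k}. -/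
theorem gaussianMean_sumSq_pow (n d : ℕ) :
    gaussianMean n (sumSq n ^ d) = ∏ j ∈ Finset.range d, ((n : ℝ) + 2 * j) := by
  induction d with
  | zero => simp [gaussianMean_one]
  | succ k ih =>
    have h (i : Fin n) : gaussianMean n (X i * (X i * sumSq n ^ k)) =
        gaussianMean n (sumSq n ^ k) +
          2 * k * gaussianMean n (X i * X i * sumSq n ^ (k - 1)) := by
      rw [gaussianMean_X_mul, Derivation.leibniz, pderiv_X_self, pderiv_pow, pderiv_sumSq,
        ← smul_eq_mul (2 * (k : ℝ)), ← map_smul, ← map_add]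
      congr 1
      simp only [smul_eq_mul, smul_eq_C_mul, map_mul, map_natCast, map_ofNat]
      ring
    have h2 : k * gaussianMean n (sumSq n * sumSq n ^ (k - 1)) =
        k * gaussianMean n (sumSq n ^ k) := by
      rcases k with _ | k
      · simp
      · rw [← pow_succ']; simp
    rw [Finset.prod_range_succ, ← ih, pow_succ']
    nth_rewrite 1 [sumSq]
    rw [Finset.sum_mul, map_sum]
    simp only [mul_assoc] at h ⊢
    simp only [h, Finset.sum_add_distrib, ← Finset.mul_sum, Finset.sum_const,
      Finset.card_univ, Fintype.card_fin, nsmul_eq_mul]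
    simp only [← map_sum, ← mul_assoc, ← Finset.sum_mul]
    rw [show ∑ i, X i * X i = sumSq n from rfl, mul_assoc, h2]
    ring

/-! ### The Laplacian and the gradient inequality for forms -/

/-- The Laplacian of a polynomial. -/
noncomputable def polyLaplacian {n : ℕ} (p : MvPolynomial (Fin n) ℝ) : MvPolynomial (Fin n) ℝ :=
  ∑ i, pderiv i (pderiv i p)

theorem pderiv_comm {n : ℕ} (i j : Fin n) (p : MvPolynomial (Fin n) ℝ) :
    pderiv i (pderiv j p) = pderiv j (pderiv i p) := by
  let D (k : Fin n) : Derivation ℝ (MvPolynomial (Fin n) ℝ) (MvPolynomial (Fin n) ℝ) := pderiv k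
  -- The commutator is again a derivation, so it is enough that it kills the variables.
  have h : ⁅D i, D j⁆ = 0 := by
    refine MvPolynomial.derivation_ext fun k => ?_
    rw [Derivation.commutator_apply]
    have hX (a b : Fin n) : D a (D b (X k)) = 0 := by
      simp only [D, pderiv_X, Pi.single_apply]
      split_ifs <;> simp
    simp [hX]
  have := congrArg (fun E => E p) h
  rw [Derivation.commutator_apply] at this
  exact sub_eq_zero.1 this

theorem pderiv_polyLaplacian {n : ℕ} (i : Fin n) (p : MvPolynomial (Fin n) ℝ) :
    pderiv i (polyLaplacian p) = polyLaplacian (pderiv i p) := by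
  simp only [polyLaplacian, map_sum]
  refine Finset.sum_congr rfl fun j _ => ?_
  rw [pderiv_comm i j, pderiv_comm i j]

/-- Euler's identity and integration by parts give, for p of degree d, d E(pΔp) = E(Δp)² + Σ E(∂ᵢp
Δ∂ᵢp). The last sum concerns forms of degree d - 1, so induction applies. -/
theorem gaussianMean_mul_polyLaplacian_nonneg {n : ℕ} (d : ℕ) {p : MvPolynomial (Fin n) ℝ}
    (hp : p.IsHomogeneous d) : 0 ≤ gaussianMean n (p * polyLaplacian p) := by
  induction d generalizing p with
  | zero =>
    obtain ⟨c, rfl⟩ : ∃ c, p = C c := ⟨_, totalDegree_eq_zero_iff_eq_C.1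
      ((totalDegree_zero_iff_isHomogeneous _).2 hp)⟩
    simp [polyLaplacian]
  | succ d ih =>
    have hE := hp.sum_X_mul_pderiv
    have h1 : ((d + 1 : ℕ) : ℝ) * gaussianMean n (p * polyLaplacian p) =
        gaussianMean n (polyLaplacian p * polyLaplacian p) +
          ∑ i, gaussianMean n (pderiv i p * polyLaplacian (pderiv i p)) := by
      rw [← nsmul_eq_mul, ← map_nsmul, ← smul_mul_assoc, ← hE, Finset.sum_mul, map_sum]
      simp only [mul_assoc, gaussianMean_X_mul, Derivation.leibniz, smul_eq_mul,
        pderiv_polyLaplacian, map_add, Finset.sum_add_distrib]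
      rw [add_comm]
      congr 1
      rw [← map_sum, ← Finset.mul_sum]
      rfl
    have h2 : 0 ≤ gaussianMean n (polyLaplacian p * polyLaplacian p) :=
      gaussianMean_nonneg fun z => by rw [map_mul]; exact mul_self_nonneg _
    have h3 : 0 ≤ ∑ i, gaussianMean n (pderiv i p * polyLaplacian (pderiv i p)) :=
      Finset.sum_nonneg fun i _ => ih (by simpa using hp.pderiv (i := i))
    have h4 : (0 : ℝ) < ((d + 1 : ℕ) : ℝ) := by positivity
    exact nonneg_of_mul_nonneg_right (h1 ▸ add_nonneg h2 h3) h4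

/-- By parts and Euler, the difference of the two sides is exactly E(pΔp). -/
theorem sum_gaussianMean_pderiv_sq_le {n d : ℕ} {p : MvPolynomial (Fin n) ℝ}
    (hp : p.IsHomogeneous d) :
    ∑ i, gaussianMean n (pderiv i p * pderiv i p) ≤ d * gaussianMean n (p * p) := by
  have h (i : Fin n) : gaussianMean n (pderiv i p * pderiv i p) =
      gaussianMean n (p * (X i * pderiv i p)) - gaussianMean n (p * pderiv i (pderiv i p)) := by
    rw [mul_left_comm, gaussianMean_X_mul, Derivation.leibniz, map_add]
    simp
  have h2 : ∑ i, gaussianMean n (pderiv i p * pderiv i p) =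
      d * gaussianMean n (p * p) - gaussianMean n (p * polyLaplacian p) := by
    simp only [h, Finset.sum_sub_distrib, ← map_sum, ← Finset.mul_sum, hp.sum_X_mul_pderiv]
    rw [mul_smul_comm, map_nsmul, nsmul_eq_mul]
    rfl
  linarith [gaussianMean_mul_polyLaplacian_nonneg d hp]

/-! ### Forms of symmetric arrays and their slices -/

/-- The form `∑ t_{i₁…i_d} X_{i₁} ⋯ X_{i_d}` of an array `t`. -/
noncomputable def tensorForm {d n : ℕ} (t : (Fin d → Fin n) → ℝ) : MvPolynomial (Fin n) ℝ :=
  ∑ i, C (t i) * ∏ j, X (i j)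

/-- Invariance of an array under permutations of its indices. -/
def IsSymmArray {d n : ℕ} (t : (Fin d → Fin n) → ℝ) : Prop :=
  ∀ (σ : Equiv.Perm (Fin d)) i, t (i ∘ σ) = t i

theorem tensorForm_isHomogeneous {d n : ℕ} (t : (Fin d → Fin n) → ℝ) :
    (tensorForm t).IsHomogeneous d := by
  refine IsHomogeneous.sum _ _ _ fun i _ => ?_
  have h := (isHomogeneous_C (Fin n) (t i)).mul
    (IsHomogeneous.prod Finset.univ (fun j => (X (i j) : MvPolynomial (Fin n) ℝ)) (fun _ => 1)
      fun j _ => isHomogeneous_X _ _)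
  simpa using h

theorem sum_fin_succ_fun {d n : ℕ} {M : Type*} [AddCommMonoid M] (f : (Fin (d + 1) → Fin n) → M) :
    ∑ i, f i = ∑ k, ∑ i, f (Fin.cons k i) := by
  rw [← Fintype.sum_prod_type' (f := fun k i => f (Fin.cons k i))]
  exact (Fintype.sum_equiv (Fin.consEquiv fun _ => Fin n) _ _ fun _ => rfl).symm

theorem tensorForm_succ {d n : ℕ} (t : (Fin (d + 1) → Fin n) → ℝ) :
    tensorForm t = ∑ k, X k * tensorForm fun i => t (Fin.cons k i) := by
  simp only [tensorForm, sum_fin_succ_fun, Finset.mul_sum, Fin.prod_univ_succ, Fin.cons_zero,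
    Fin.cons_succ]
  exact Finset.sum_congr rfl fun _ _ => Finset.sum_congr rfl fun _ _ => by ring

theorem IsSymmArray.slice {d n : ℕ} {t : (Fin (d + 1) → Fin n) → ℝ} (ht : IsSymmArray t)
    (k : Fin n) : IsSymmArray fun i => t (Fin.cons k i) := by
  intro σ i
  beta_reduce
  -- This permutation fixes 0 and acts as σ on the successors.
  rw [← ht (Equiv.Perm.decomposeFin.symm (0, σ)) (Fin.cons k i)]
  congr 1
  funext j
  refine Fin.cases ?_ (fun j => ?_) j <;> simp

theorem IsSymmArray.slice_comm {d n : ℕ} {t : (Fin (d + 2) → Fin n) → ℝ} (ht : IsSymmArray t)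
    (k m : Fin n) (i : Fin d → Fin n) :
    t (Fin.cons k (Fin.cons m i)) = t (Fin.cons m (Fin.cons k i)) := by
  rw [← ht (Equiv.swap 0 1) (Fin.cons m (Fin.cons k i))]
  congr 1
  funext j
  refine Fin.cases ?_ (fun j => Fin.cases ?_ (fun j => ?_) j) j
  · rw [Function.comp_apply, Equiv.swap_apply_left, ← Fin.succ_zero_eq_one]
    simp
  · simp
  · rw [Function.comp_apply, Equiv.swap_apply_of_ne_of_ne (Fin.succ_ne_zero _)]
    · simp
    · rw [← Fin.succ_zero_eq_one, Ne, Fin.succ_inj]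
      exact Fin.succ_ne_zero _

theorem pderiv_tensorForm_eq_add {d n : ℕ} (t : (Fin (d + 1) → Fin n) → ℝ) (m : Fin n) :
    pderiv m (tensorForm t) = (tensorForm fun i => t (Fin.cons m i)) +
      ∑ k, X k * pderiv m (tensorForm fun i => t (Fin.cons k i)) := by
  rw [tensorForm_succ t, map_sum]
  simp only [Derivation.leibniz, smul_eq_mul, Finset.sum_add_distrib, pderiv_X]
  rw [add_comm]
  congr 1
  rw [Finset.sum_eq_single m] <;> simp +contextual

theorem pderiv_tensorForm {d n : ℕ} {t : (Fin (d + 1) → Fin n) → ℝ} (ht : IsSymmArray t)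
    (m : Fin n) :
    pderiv m (tensorForm t) = (d + 1) • tensorForm fun i => t (Fin.cons m i) := by
  rw [pderiv_tensorForm_eq_add, add_comm, succ_nsmul]
  congr 1
  -- What remains is Σ X_k ∂_m f_k = d • f_m, with f_k the form of the k-th slice. The induction
  -- differentiates f_k, and symmetry swaps the indices k and m.
  induction d with
  | zero => simp [tensorForm]
  | succ d ih =>
    have h (k : Fin n) : pderiv m (tensorForm fun i => t (Fin.cons k i)) =
        (d + 1) • tensorForm fun i => t (Fin.cons m (Fin.cons k i)) := by
      rw [pderiv_tensorForm_eq_add, ih (ht.slice k), add_comm, succ_nsmul]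
      simp only [ht.slice_comm k m]
    simp only [h, mul_smul_comm, ← Finset.smul_sum]
    rw [tensorForm_succ fun i => t (Fin.cons m i)]

/-- In degree d + 1 the gradient inequality reads (d+1)² Σ E f_k² ≤ (d+1) E f². Cancelling d + 1 and
applying induction to the slices f_k builds up the factorial. -/
theorem factorial_mul_sum_sq_le_gaussianMean {d n : ℕ} {t : (Fin d → Fin n) → ℝ}
    (ht : IsSymmArray t) :
    (d.factorial : ℝ) * ∑ i, t i ^ 2 ≤ gaussianMean n (tensorForm t * tensorForm t) := by
  induction d with
  | zero =>
    have h : gaussianMean n (C (t default) * C (t default)) = t default * t default := by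
      rw [← map_mul, C_eq_smul_one, map_smul, gaussianMean_one, smul_eq_mul, mul_one]
    simp [tensorForm, h, sq]
  | succ d ih =>
    have h1 := sum_gaussianMean_pderiv_sq_le (tensorForm_isHomogeneous t)
    simp only [pderiv_tensorForm ht, smul_mul_assoc, mul_smul_comm, map_nsmul] at h1
    simp only [nsmul_eq_mul, ← Finset.mul_sum] at h1
    have h2 : (d.factorial : ℝ) * ∑ i, t i ^ 2 ≤ ∑ k, gaussianMean n
        ((tensorForm fun i => t (Fin.cons k i)) * tensorForm fun i => t (Fin.cons k i)) := by
      rw [sum_fin_succ_fun, Finset.mul_sum]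
      exact Finset.sum_le_sum fun k _ => ih (ht.slice k)
    have h3 : (0 : ℝ) < ((d + 1 : ℕ) : ℝ) := by positivity
    have h4 := le_of_mul_le_mul_left h1 h3
    rw [Nat.factorial_succ, Nat.cast_mul, mul_assoc]
    exact (mul_le_mul_of_nonneg_left h2 h3.le).trans h4

/-! ### Comparison with the spectral norm -/

theorem abs_inner_rankOneTensor_le {d n : ℕ} (hn : 1 ≤ n) (T : RealTensor d n)
    (x : Fin d → EuclideanSpace ℝ (Fin n)) (hx : ∀ j, ‖x j‖ = 1) :
    |inner ℝ T (rankOneTensor x)| ≤ tensorSpectralNorm T :=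
  (isGreatest_tensorSpectralNorm hn T).2 ⟨x, hx, rfl⟩

theorem tensorSpectralNorm_nonneg {d n : ℕ} (T : RealTensor d n) : 0 ≤ tensorSpectralNorm T :=
  Real.sSup_nonneg fun _ ⟨_, _, h⟩ => h ▸ abs_nonneg _

theorem inner_rankOneTensor {d n : ℕ} (T : RealTensor d n)
    (x : Fin d → EuclideanSpace ℝ (Fin n)) :
    inner ℝ T (rankOneTensor x) = ∑ i, T i * ∏ j, x j (i j) := by
  simp [rankOneTensor, PiLp.inner_apply, mul_comm]

theorem exists_norm_smul_unit {n : ℕ} (hn : 1 ≤ n) (z : EuclideanSpace ℝ (Fin n)) :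
    ∃ x : EuclideanSpace ℝ (Fin n), ‖x‖ = 1 ∧ z = ‖z‖ • x := by
  by_cases hz : z = 0
  · exact ⟨EuclideanSpace.single ⟨0, hn⟩ 1, by simp, by simp [hz]⟩
  · have hz' := norm_ne_zero_iff.2 hz
    exact ⟨‖z‖⁻¹ • z, by simp [norm_smul, hz'], by rw [smul_inv_smul₀ hz']⟩

theorem eval_tensorForm_sq_le {d n : ℕ} (hn : 1 ≤ n) (T : RealTensor d n) (z : Fin n → ℝ) :
    eval z (tensorForm T * tensorForm T) ≤ tensorSpectralNorm T ^ 2 * eval z (sumSq n ^ d) := by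
  obtain ⟨x, hx, hz⟩ := exists_norm_smul_unit hn (WithLp.toLp 2 z)
  set r := ‖WithLp.toLp 2 z‖ with hr
  have h1 : eval z (sumSq n) = r ^ 2 := by
    rw [hr, EuclideanSpace.norm_sq_eq]
    simp [sumSq, sq]
  have hzk (k : Fin n) : z k = r * x k := by simpa using congrArg (fun y => y k) hz
  have h2 : eval z (tensorForm T) = r ^ d * inner ℝ T (rankOneTensor fun _ => x) := by
    rw [inner_rankOneTensor, Finset.mul_sum]
    simp only [tensorForm, map_sum, map_mul, eval_C, map_prod, eval_X, hzk,
      Finset.prod_mul_distrib, Finset.prod_const, Finset.card_univ, Fintype.card_fin]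
    exact Finset.sum_congr rfl fun _ _ => by ring
  have h3 := abs_inner_rankOneTensor_le hn T (fun _ => x) fun _ => hx
  rw [map_mul, map_pow, h1, h2, ← pow_mul, mul_comm 2 d, pow_mul]
  have h4 : (inner ℝ T (rankOneTensor fun _ => x)) ^ 2 ≤ tensorSpectralNorm T ^ 2 :=
    sq_le_sq' (abs_le.1 h3).1 (abs_le.1 h3).2
  nlinarith [mul_le_mul_of_nonneg_left h4 (sq_nonneg (r ^ d))]

theorem factorial_mul_norm_sq_le {d n : ℕ} (hn : 1 ≤ n) {T : RealTensor d n}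
    (hT : T ∈ symTensor d n) :
    (d.factorial : ℝ) * ‖T‖ ^ 2 ≤
      tensorSpectralNorm T ^ 2 * ∏ j ∈ Finset.range d, ((n : ℝ) + 2 * j) := by
  have h1 := factorial_mul_sum_sq_le_gaussianMean (t := T) hT
  have h2 : 0 ≤ gaussianMean n
      (tensorSpectralNorm T ^ 2 • sumSq n ^ d - tensorForm T * tensorForm T) := by
    refine gaussianMean_nonneg fun z => ?_
    rw [map_sub, smul_eval]
    exact sub_nonneg.2 (eval_tensorForm_sq_le hn T z)
  rw [map_sub, map_smul, gaussianMean_sumSq_pow, smul_eq_mul] at h2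
  rw [EuclideanSpace.norm_sq_eq]
  simp only [Real.norm_eq_abs, sq_abs]
  linarith

/-- Factor by factor, n + 2j ≤ 2(n + j); the product of the n + j is a rising factorial. -/
theorem prod_add_two_mul_le {d n : ℕ} (hn : 1 ≤ n) :
    ∏ j ∈ Finset.range d, ((n : ℝ) + 2 * j) ≤
      2 ^ d * (d.factorial * ((d + n - 1).choose d : ℝ)) := by
  have h : (d.factorial * (d + n - 1).choose d : ℕ) = ∏ j ∈ Finset.range d, (n + j) := by
    rw [← Nat.ascFactorial_eq_prod_range, Nat.ascFactorial_eq_factorial_mul_choose']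
    rw [add_comm n d]
  rw [← Nat.cast_mul, h, Nat.cast_prod, ← Finset.card_range d, ← Finset.prod_const,
    Finset.card_range, ← Finset.prod_mul_distrib]
  refine Finset.prod_le_prod (fun _ _ => by positivity) fun j _ => ?_
  push_cast
  linarith [(n.cast_nonneg : (0 : ℝ) ≤ n)]

theorem norm_sq_le_two_pow_mul_choose {d n : ℕ} (hn : 1 ≤ n) {T : RealTensor d n}
    (hT : T ∈ symTensor d n) :
    ‖T‖ ^ 2 ≤ tensorSpectralNorm T ^ 2 * (2 ^ d * ((d + n - 1).choose d : ℝ)) := by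
  have h1 := factorial_mul_norm_sq_le hn hT
  have h2 := mul_le_mul_of_nonneg_left (prod_add_two_mul_le (d := d) hn)
    (sq_nonneg (tensorSpectralNorm T))
  have h3 : (0 : ℝ) < d.factorial := by positivity
  refine le_of_mul_le_mul_left ((h1.trans h2).trans_eq ?_) h3
  ring

/-! ### The slice bound and conclusion -/

/-- Every slice of a tensor has Euclidean norm at most its spectral norm. -/
theorem sum_slice_sq_le {d n : ℕ} (hn : 1 ≤ n) (T : RealTensor (d + 1) n) (i : Fin d → Fin n) :
    ∑ k, T (Fin.cons k i) ^ 2 ≤ tensorSpectralNorm T ^ 2 := by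
  set v : EuclideanSpace ℝ (Fin n) := WithLp.toLp 2 fun k => T (Fin.cons k i) with hv
  obtain ⟨x, hx, hvx⟩ := exists_norm_smul_unit hn v
  -- Test T on the direction of v in the first slot and on basis vectors in the others; the pairing
  -- is then ⟨v, x⟩ = ‖v‖.
  have h := abs_inner_rankOneTensor_le hn T
    (Fin.cons x fun j => EuclideanSpace.single (i j) (1 : ℝ))
    (fun j => Fin.cases (by simpa using hx) (fun j => by simp) j)
  have h2 : inner ℝ T (rankOneTensor
      (Fin.cons x fun j => EuclideanSpace.single (i j) (1 : ℝ))) = inner ℝ v x := by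
    rw [inner_rankOneTensor, sum_fin_succ_fun]
    simp only [Fin.prod_univ_succ, Fin.cons_zero, Fin.cons_succ]
    rw [PiLp.inner_apply]
    refine Finset.sum_congr rfl fun k _ => ?_
    rw [Finset.sum_eq_single i]
    · simp [hv, mul_comm]
    · intro l _ hl
      obtain ⟨j, hj⟩ := Function.ne_iff.1 hl
      rw [Finset.prod_eq_zero (Finset.mem_univ j) (by simp [hj])]
      simp
    · simp
  have h3 : inner ℝ v x = ‖v‖ := by
    nth_rewrite 1 [hvx]
    rw [real_inner_smul_left, real_inner_self_eq_norm_sq, hx]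
    simp
  rw [h2, h3, abs_norm] at h
  have h4 : ‖v‖ ^ 2 = ∑ k, T (Fin.cons k i) ^ 2 := by
    rw [EuclideanSpace.norm_sq_eq]
    simp [hv]
  rw [← h4]
  exact pow_le_pow_left₀ (norm_nonneg _) h 2

theorem norm_sq_le_pow_mul {d n : ℕ} (hn : 1 ≤ n) (T : RealTensor (d + 1) n) :
    ‖T‖ ^ 2 ≤ tensorSpectralNorm T ^ 2 * (n : ℝ) ^ d := by
  rw [EuclideanSpace.norm_sq_eq]
  simp only [Real.norm_eq_abs, sq_abs]
  rw [sum_fin_succ_fun, Finset.sum_comm]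
  refine (Finset.sum_le_sum fun i _ => sum_slice_sq_le hn T i).trans_eq ?_
  simp [mul_comm]

theorem one_div_sqrt_le_ratio {d n : ℕ} {T : RealTensor d n} (hT : T ≠ 0) {c : ℝ} (hc : 0 < c)
    (h : ‖T‖ ^ 2 ≤ tensorSpectralNorm T ^ 2 * c) :
    1 / √c ≤ tensorSpectralNorm T / ‖T‖ := by
  rw [div_le_div_iff₀ (Real.sqrt_pos.2 hc) (norm_pos_iff.2 hT), one_mul]
  refine abs_le_of_sq_le_sq' ?_ (mul_nonneg (tensorSpectralNorm_nonneg T) (Real.sqrt_nonneg c)) |>.2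
  rwa [mul_pow, Real.sq_sqrt hc.le]

end

theorem proposition4p2 (d n : ℕ) (hd : 1 ≤ d) (hn : 2 ≤ n) :
    max (1 / (2 : ℝ) ^ ((d : ℝ) / 2) * (((d + n - 1).choose d : ℕ) : ℝ) ^ (-(1 / 2) : ℝ))
        (1 / (n : ℝ) ^ (((d : ℝ) - 1) / 2))
      ≤ symRankOneRatio d n := by
  have hn1 : 1 ≤ n := by omega
  obtain ⟨T, hT, hT0, hr⟩ := (isLeast_symRankOneRatio (d := d) hn1).1
  rw [hr]
  refine max_le ?_ ?_
  · have hc : (0 : ℝ) < ((d + n - 1).choose d : ℕ) := by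
      exact_mod_cast Nat.choose_pos (by omega)
    refine Eq.trans_le ?_ (one_div_sqrt_le_ratio hT0 (by positivity)
      (norm_sq_le_two_pow_mul_choose hn1 hT))
    rw [Real.sqrt_mul (by positivity), one_div_mul_eq_div, Real.rpow_neg hc.le,
      ← Real.sqrt_eq_rpow, Real.sqrt_eq_rpow (2 ^ d), ← Real.rpow_natCast_mul (by norm_num)]
    field_simp
  -- One index is split off for the slices, which leaves the exponent d - 1.
  · obtain ⟨e, rfl⟩ : ∃ e, d = e + 1 := ⟨d - 1, by omega⟩
    have hn0 : (0 : ℝ) < n := by positivity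
    refine Eq.trans_le ?_ (one_div_sqrt_le_ratio hT0 (by positivity) (norm_sq_le_pow_mul hn1 T))
    rw [Real.sqrt_eq_rpow, ← Real.rpow_natCast_mul hn0.le]
    congr 2
    push_cast
    ring
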